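/- Let $k$ be an integer with $12\nmid k$, let $R$ be a non-zero real number, and let $v=v_\eta^{2k}$, where $v_\eta$ is the multiplier system of the Dedekind eta function, $\eta(gz)=v_\eta(g)\,(cz+d)^{1/2}\,\eta(z)$ for $g=\left(\begin{smallmatrix}a&b\\c&d\end{smallmatrix}\right)\in SL(2,\mathbb Z)$ (principal branch). Put $e(x)=e^{2\pi i x}$, $\xi=v\left(\begin{smallmatrix}1&1\\0&1\end{smallmatrix}\right)=e(k/12)$, $D=k/(12,k)$, and $\chi_k(d)=i^{k(d-1)}$. Let $\mathcal M(v,k,R)$ be the space of Maass waveforms: functions $f$ on the upper half-plane $\mathbb H$ of class $C^2$ such that $e^{-ik\,\mathrm{Arg}(cz+d)}f(gz)=v(g)f(z)$ for all $g\in SL(2,\mathbb Z)$ ($\mathrm{Arg}\in(-\pi,\pi]$), $(\Delta_k+\tfrac14+R^2)f=0$ with $\Delta_k=y^2\left(\frac{\partial^2}{\partial x^2}+\frac{\partial^2}{\partial y^2}\right)-iky\frac{\partial}{\partial x}$, and $\int_{SL(2,\mathbb Z)\backslash\mathbb H}|f|^2\,\frac{dx\,dy}{y^2}<\infty$. For a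 positive integer $m$ with $km\equiv k \pmod{12}$ define the Hecke operator $$T_mf(z)=\frac1{\sqrt m}\sum_{ad=m,\ d>0}\chi_k(d)\sum_{b \bmod d}\xi^{-bd}f\left(\frac{az+b}{d}\right).$$ Proposition. Let $f\in\mathcal M(v,k,R)$, $f\neq0$, be an eigenfunction of all $T_m$ with $m>0$, $km\equiv k\pmod{12}$, say $T_mf=\lambda_mf$. Then for all positive integers $m,n$ with $km\equiv kn\equiv k\pmod{12}$ $$\lambda_m\lambda_n=\sum_{0<d\mid(m,n)}\chi_k(d)\,\lambda_{mn/d^2}.$$ Furthermore, suppose that $f(z)=\sum_{j\in\mathbb Z}c(j)\,\mathcal W_{j,k,R}(z)$ for every $z=x+iy\in\mathbb H$ (absolutely convergent), where, with $\nu=j+\frac k{12}$, $$\mathcal W_{j,k,R}(x+iy)=|\nu|^{-1/2}\,W_{\frac k2\mathrm{sgn}(\nu),\,iR}(4\pi|\nu|y)\,e(\nu x)$$ and $W_{\kappa,\mu}$ is Whittaker's $W$-function. Then for all positive integers $m,n$ with $km\equiv kn\equiv k\pmod{12}$ and $(m,D)=(n,D)=1$ $$c\left(k\tfrac{m-1}{12}\right)c\left(k\tfrac{n-1}{12}\right)=c(0)\sum_{0<d\mid(m,n)}\chi_k(d)\,c\left(k\tfrac{mn-d^2}{12d^2}\right),$$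 where all the arguments of $c$ are integers. -/

import Mathlib

open scoped UpperHalfPlane MatrixGroups
open MeasureTheory

namespace MaassHecke

noncomputable section

/-- `e(x) = exp(2 π i x)` for real `x`. -/
def e (x : ℝ) : ℂ := Complex.exp (2 * Real.pi * Complex.I * x)

/-! ### Automorphy factor, slash action and eta multiplier system -/

/-- `j_g(z; k) = exp(i k Arg(c z + d))` for `g = (a, b; c, d)`, with the principal argument. -/
def automorphyFactor (k : ℤ) (g : SL(2, ℤ)) (z : ℍ) : ℂ :=
  Complex.exp (Complex.I * k * Complex.arg (UpperHalfPlane.denom g z))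

/-- The weight `k` action `(f|[k, g])(z) = j_g(z; k)⁻¹ f(g z)`. -/
def slash (k : ℤ) (g : SL(2, ℤ)) (f : ℍ → ℂ) (z : ℍ) : ℂ :=
  (automorphyFactor k g z)⁻¹ * f (g • z)

/-- The multiplier system `v_η` of the Dedekind eta function, defined by
`η(g z) = v_η(g) (c z + d)^(1/2) η(z)` (principal branch); the quotient does not depend on
`z ∈ ℍ`, and is evaluated at `z = i`. -/
def etaMultiplier (g : SL(2, ℤ)) : ℂ :=
  ModularForm.eta (g • UpperHalfPlane.I : ℍ) /
    ((UpperHalfPlane.denom g UpperHalfPlane.I) ^ (1 / 2 : ℂ) *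
      ModularForm.eta (UpperHalfPlane.I : ℍ))

/-- The multiplier system `v = v_η ^ (2k)`, of weight `k`. -/
def multiplier (k : ℤ) (g : SL(2, ℤ)) : ℂ := etaMultiplier g ^ (2 * k)

/-! ### Maass waveforms -/

/-- `∂F/∂x` for a function `F` of `x + i y`. -/
def partialX (F : ℂ → ℂ) (w : ℂ) : ℂ := fderiv ℝ F w 1

/-- `∂F/∂y` for a function `F` of `x + i y`. -/
def partialY (F : ℂ → ℂ) (w : ℂ) : ℂ := fderiv ℝ F w Complex.I

/-- The weight `k` Laplacian `Δ_k = y² (∂²/∂x² + ∂²/∂y²) - i k y ∂/∂x`. The function `f` on `ℍ`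
is extended to `ℂ` in some way, which does not affect derivatives at points of the open set `ℍ`. -/
def laplacian (k : ℤ) (f : ℍ → ℂ) (z : ℍ) : ℂ :=
  let F : ℂ → ℂ := f ∘ UpperHalfPlane.ofComplex
  (z.im : ℂ) ^ 2 * (partialX (partialX F) z + partialY (partialY F) z)
    - Complex.I * k * z.im * partialX F z

/-- `f` is a Maass waveform on `SL(2, ℤ)` of weight `k`, multiplier system `v` and spectral
parameter `R`, that is, with Laplace eigenvalue `1/4 + R²`. `ModularGroup.fd` is the standard
fundamental domain, and `volume` on `ℍ` is the hyperbolic measure `dx dy / y²`. -/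
structure IsMaassWaveform (v : SL(2, ℤ) → ℂ) (k : ℤ) (R : ℝ) (f : ℍ → ℂ) : Prop where
  contDiffOn : ContDiffOn ℝ 2 (f ∘ UpperHalfPlane.ofComplex) {w : ℂ | 0 < w.im}
  slash_eq : ∀ (g : SL(2, ℤ)) (z : ℍ), slash k g f z = v g * f z
  laplacian_eq : ∀ z : ℍ, laplacian k f z + (1 / 4 + (R : ℂ) ^ 2) * f z = 0
  square_integrable :
    IntegrableOn (fun z : ℍ => ‖f z‖ ^ 2) ModularGroup.fd (volume : Measure ℍ)

/-! ### Whittaker functions and Fourier expansions -/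

/-- Kummer's function `₁F₁(a; c; x) = ∑ (a)_n x^n / ((c)_n n!)`, for `c ≠ 0, -1, -2, …`. -/
def kummer (a c x : ℂ) : ℂ := Complex.Gamma c * Complex.regularizedHGFun {a} {c} x

/-- Whittaker's function `M_{κ,μ}(x) = e^(-x/2) x^(1/2+μ) ₁F₁(1/2 + μ - κ; 1 + 2μ; x)`, `x > 0`. -/
def whittakerM (κ μ : ℂ) (x : ℝ) : ℂ :=
  Complex.exp (-x / 2) * (x : ℂ) ^ (1 / 2 + μ) * kummer (1 / 2 + μ - κ) (1 + 2 * μ) x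

/-- Whittaker's function `W_{κ,μ}(x)`, for `x > 0` and `2μ` not an integer:
`W_{κ,μ} = Γ(-2μ) / Γ(1/2 - μ - κ) * M_{κ,μ} + Γ(2μ) / Γ(1/2 + μ - κ) * M_{κ,-μ}`. -/
def whittakerW (κ μ : ℂ) (x : ℝ) : ℂ :=
  Complex.Gamma (-2 * μ) / Complex.Gamma (1 / 2 - μ - κ) * whittakerM κ μ x
    + Complex.Gamma (2 * μ) / Complex.Gamma (1 / 2 + μ - κ) * whittakerM κ (-μ) x

/-- `𝒲_{n,k,R}(x + i y)
  = |n + α|^(-1/2) W_{(k/2) sgn(n + α), iR}(4 π |n + α| y) e((n + α) x)` with `α = k / 12`. -/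
def fourierTerm (n k : ℤ) (R : ℝ) (z : ℍ) : ℂ :=
  let ν : ℝ := (n : ℝ) + (k : ℝ) / 12
  1 / (Real.sqrt |ν| : ℂ)
    * whittakerW ((k : ℂ) / 2 * (SignType.sign ν : ℝ)) (Complex.I * R) (4 * Real.pi * |ν| * z.im)
    * e (ν * z.re)

/-- `f(z) = ∑_{n ∈ ℤ} c(n) 𝒲_{n,k,R}(z)` on `ℍ`. -/
def HasFourierExpansion (k : ℤ) (R : ℝ) (f : ℍ → ℂ) (c : ℤ → ℂ) : Prop :=
  ∀ z : ℍ, HasSum (fun n : ℤ => c n * fourierTerm n k R z) (f z)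

/-! ### Hecke operators -/

/-- `χ_k(d) = i^(k (d - 1))`. -/
def chi (k : ℤ) (d : ℕ) : ℂ := Complex.I ^ (k * ((d : ℤ) - 1))

/-- The Hecke operator, with `ξ = e(k / 12)`,
`T_m f(z) = m^(-1/2) ∑_{a d = m, d > 0} χ_k(d) ∑_{b mod d} ξ^(-b d) f((a z + b) / d)`,
for a positive integer `m` with `k m ≡ k mod 12`. -/
def hecke (k : ℤ) (m : ℕ) (f : ℍ → ℂ) (z : ℍ) : ℂ :=
  1 / (Real.sqrt m : ℂ) * ∑ p ∈ m.divisorsAntidiagonal, chi k p.2 *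
    ∑ b ∈ Finset.range p.2, e ((k : ℝ) / 12) ^ (-((b : ℤ) * p.2)) *
      f (UpperHalfPlane.ofComplex (((p.1 : ℂ) * z + b) / p.2))

/-- `D = k / (12, k)`. -/
def D (k : ℤ) : ℤ := k / (Int.gcd 12 k : ℤ)

/-- The index `k (m - 1) / 12`, an integer if `k m ≡ k mod 12` (`twelve_dvd`). -/
def index (k : ℤ) (m : ℕ) : ℤ := k * ((m : ℤ) - 1) / 12

/-- The index `k (m n - d²) / (12 d²)`, an integer if `k m ≡ k n ≡ k mod 12` and `d ∣ (m, n)`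
(`twelve_mul_sq_dvd`). -/
def indexMul (k : ℤ) (m n d : ℕ) : ℤ := k * ((m : ℤ) * n - (d : ℤ) ^ 2) / (12 * (d : ℤ) ^ 2)

theorem twelve_dvd {k : ℤ} {m : ℕ} (hm : k * m ≡ k [ZMOD 12]) :
    (12 : ℤ) ∣ k * ((m : ℤ) - 1) := by
  have h := hm.symm.dvd
  rwa [mul_sub, mul_one]

theorem twelve_mul_sq_dvd {k : ℤ} {m n d : ℕ} (hm : k * m ≡ k [ZMOD 12])
    (hn : k * n ≡ k [ZMOD 12]) (hd : d ∣ Nat.gcd m n) :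
    12 * (d : ℤ) ^ 2 ∣ k * ((m : ℤ) * n - (d : ℤ) ^ 2) := by
  obtain ⟨a, rfl⟩ := hd.trans (Nat.gcd_dvd_left m n)
  obtain ⟨b, rfl⟩ := hd.trans (Nat.gcd_dvd_right _ n)
  have key : (12 : ℤ) ∣ k * ((a : ℤ) * b - 1) := by
    have h1 := twelve_dvd hm
    have h2 := twelve_dvd hn
    push_cast at h1 h2
    have hz : ∀ κ δ α β : ZMod 12, κ * (δ * α - 1) = 0 → κ * (δ * β - 1) = 0 →
        κ * (α * β - 1) = 0 := by decide +kernel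
    have h1' := (ZMod.intCast_zmod_eq_zero_iff_dvd _ 12).2 h1
    have h2' := (ZMod.intCast_zmod_eq_zero_iff_dvd _ 12).2 h2
    apply (ZMod.intCast_zmod_eq_zero_iff_dvd _ 12).1
    push_cast at h1' h2' ⊢
    exact hz _ _ _ _ h1' h2'
  obtain ⟨t, ht⟩ := key
  refine ⟨t, ?_⟩
  push_cast
  linear_combination (d : ℤ) ^ 2 * ht

end

end MaassHecke

namespace MaassHecke

/-! ### The additive character `e` -/

/-! Both identities come from the algebra of upper triangular matrices. Since `η(z + 1) = e(1/24)
η(z)`, a waveform satisfies `f(z + 1) = ξ f(z)`, and this alone gives `T_m T_n = ∑ χ_k(d) T_{mn/d²}`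
on `f` (`hecke_hecke`). Indeed `(a, b; 0, d)` followed by `(a', b'; 0, d')` is `(aa', a'b + db'; 0,
dd')`, and the twists multiply correctly because `k n ≡ k` and `k d² ≡ k` mod 12. As `b`, `b'` vary,
the upper right entry runs over the multiples of `g = (a', d)`, each taken `g` times; so `g` can be
removed from the matrix at the price of `g χ_k(g)`, and what remains enumerates the factorizations
of `mn/g²`. Evaluating at a point where `f ≠ 0` yields the relation between eigenvalues.

For the coefficients, compare the frequency `k/12` on both sides of `T_m f = λ_m f`. In the part of
`T_m f` belonging to `ad = m`, the sum over `b` is geometric with ratio `e(-k(m - 1)/(12a))`. It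
vanishes unless `a` divides `k(m - 1)/12`, and `(m, D) = 1` then forces `a = 1`
(`eq_one_of_dvd_index`). Hence `c(k(m - 1)/12) = λ_m c(0)` (`fourierCoeff_index_eq`); cancelling the
common Whittaker factor is legitimate because `W` is not identically zero
(`exists_whittakerW_ne_zero`). Multiplying the eigenvalue relation by `c(0)²` finishes the proof. -/

theorem e_add (x y : ℝ) : e (x + y) = e x * e y := by
  simp only [e, ← Complex.exp_add]
  push_cast
  ring_nf

theorem e_int (n : ℤ) : e n = 1 := by
  rw [e, ← Complex.exp_int_mul_two_pi_mul_I n]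
  push_cast
  ring_nf

theorem e_eq_e_of_sub_eq_int {x y : ℝ} (n : ℤ) (h : x - y = n) : e x = e y := by
  rw [← sub_add_cancel x y, e_add, h, e_int, one_mul]

theorem e_zpow (x : ℝ) (n : ℤ) : e x ^ n = e (n * x) := by
  rw [e, e, ← Complex.exp_int_mul]
  push_cast
  ring_nf

theorem e_pow (x : ℝ) (n : ℕ) : e x ^ n = e (n * x) := by
  exact_mod_cast e_zpow x n

theorem norm_e (x : ℝ) : ‖e x‖ = 1 := by
  rw [e, Complex.norm_exp]
  simp

theorem exists_int_of_e_eq_one {x : ℝ} (h : e x = 1) : ∃ n : ℤ, x = n := by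
  obtain ⟨n, hn⟩ := Complex.exp_eq_one_iff.1 h
  refine ⟨n, ?_⟩
  have h2 : (2 * Real.pi * Complex.I : ℂ) ≠ 0 := Complex.two_pi_I_ne_zero
  have : (x : ℂ) = n := mul_left_cancel₀ h2 (by rw [hn]; ring)
  exact_mod_cast this

theorem continuous_e : Continuous e := by
  unfold e
  fun_prop

/-! ### Behaviour under the translation `z ↦ z + 1` -/

theorem eta_add_one (z : ℂ) : ModularForm.eta (z + 1) = e (1 / 24) * ModularForm.eta z := by
  have h1 : Function.Periodic.qParam 24 (z + 1) = e (1 / 24) * Function.Periodic.qParam 24 z := by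
    rw [Function.Periodic.qParam, Function.Periodic.qParam, e, ← Complex.exp_add]
    congr 1
    push_cast
    ring
  have h2 : ∀ n, ModularForm.eta_q n (z + 1) = ModularForm.eta_q n z := by
    intro n
    rw [ModularForm.eta_q_eq_pow, ModularForm.eta_q_eq_pow, mul_add, mul_one, Complex.exp_add,
      Complex.exp_two_pi_mul_I, mul_one]
  simp only [ModularForm.eta, h1, h2]
  ring

theorem denom_T (z : ℍ) : UpperHalfPlane.denom ModularGroup.T z = 1 := by
  rw [ModularGroup.denom_apply]
  simp [ModularGroup.T]

theorem etaMultiplier_T : etaMultiplier ModularGroup.T = e (1 / 24) := by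
  have hI : ModularForm.eta (UpperHalfPlane.I : ℍ) ≠ 0 :=
    ModularForm.eta_ne_zero UpperHalfPlane.I.coe_im_pos
  rw [etaMultiplier, UpperHalfPlane.modular_T_smul, UpperHalfPlane.coe_vadd, add_comm,
    Complex.ofReal_one, eta_add_one, denom_T, Complex.one_cpow, one_mul, mul_div_assoc,
    div_self hI, mul_one]

theorem multiplier_T (k : ℤ) : multiplier k ModularGroup.T = e (k / 12) := by
  rw [multiplier, etaMultiplier_T, e_zpow]
  congr 1
  push_cast
  ring

theorem IsMaassWaveform.apply_vadd_one {k : ℤ} {R : ℝ} {f : ℍ → ℂ}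
    (hf : IsMaassWaveform (multiplier k) k R f) (z : ℍ) :
    f ((1 : ℝ) +ᵥ z) = e (k / 12) * f z := by
  have h := hf.slash_eq ModularGroup.T z
  rwa [slash, automorphyFactor, denom_T, Complex.arg_one, Complex.ofReal_zero, mul_zero,
    Complex.exp_zero, inv_one, one_mul, UpperHalfPlane.modular_T_smul, multiplier_T] at h

theorem IsMaassWaveform.comp_ofComplex_add_one {k : ℤ} {R : ℝ} {f : ℍ → ℂ}
    (hf : IsMaassWaveform (multiplier k) k R f) {w : ℂ} (hw : 0 < w.im) :
    f (UpperHalfPlane.ofComplex (w + 1)) = e (k / 12) * f (UpperHalfPlane.ofComplex w) := by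
  lift w to ℍ using hw
  have h : (w : ℂ) + 1 = (((1 : ℝ) +ᵥ w : ℍ) : ℂ) := by
    rw [UpperHalfPlane.coe_vadd, Complex.ofReal_one, add_comm]
  rw [h, UpperHalfPlane.ofComplex_apply, UpperHalfPlane.ofComplex_apply, hf.apply_vadd_one]

/-! ### Arithmetic of the character `χ_k` -/

/-- The hypothesis makes `d` a unit modulo `12/(12, k)`, and the square of a unit modulo a divisor
of 12 is 1. -/
theorem mul_sq_modEq {k : ℤ} {m d : ℕ} (hm : k * m ≡ k [ZMOD 12]) (hd : d ∣ m) :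
    k * (d : ℤ) ^ 2 ≡ k [ZMOD 12] := by
  obtain ⟨a, rfl⟩ := hd
  have hz : ∀ κ δ α : ZMod 12, κ * (δ * α) = κ → κ * δ ^ 2 = κ := by decide +kernel
  have h := (ZMod.intCast_eq_intCast_iff _ _ 12).2 hm
  apply (ZMod.intCast_eq_intCast_iff _ _ 12).1
  push_cast at h ⊢
  exact hz _ _ _ h

theorem twelve_dvd_mul_sq_sub_one {k : ℤ} {d : ℕ} (hd : k * (d : ℤ) ^ 2 ≡ k [ZMOD 12]) :
    (12 : ℤ) ∣ k * ((d : ℤ) ^ 2 - 1) := by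
  simpa [mul_sub] using hd.symm.dvd

theorem chi_eq_one {k : ℤ} {m : ℕ} (hm : k * m ≡ k [ZMOD 12]) : chi k m = 1 := by
  obtain ⟨t, ht⟩ := twelve_dvd hm
  rw [chi, ht, zpow_mul, show (12 : ℤ) = ((4 * 3 : ℕ) : ℤ) by norm_num, zpow_natCast,
    pow_mul, Complex.I_pow_four, one_pow, one_zpow]

/-- The exponents differ by `k(d - 1)(d' - 1)`, a multiple of 4: if `d` or `d'` is even, the
congruence forces `4 ∣ k`; otherwise both factors are even. -/
theorem chi_mul {k : ℤ} {d d' : ℕ} (hd : k * (d : ℤ) ^ 2 ≡ k [ZMOD 12])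
    (hd' : k * (d' : ℤ) ^ 2 ≡ k [ZMOD 12]) : chi k (d * d') = chi k d * chi k d' := by
  have hz : ∀ κ δ δ' : ZMod 4, κ * δ ^ 2 = κ → κ * δ' ^ 2 = κ → κ * ((δ - 1) * (δ' - 1)) = 0 := by
    decide +kernel
  have h1 := (ZMod.intCast_eq_intCast_iff _ _ 4).2 (hd.of_mul_right 3 : _ ≡ _ [ZMOD 4])
  have h2 := (ZMod.intCast_eq_intCast_iff _ _ 4).2 (hd'.of_mul_right 3 : _ ≡ _ [ZMOD 4])
  push_cast at h1 h2
  obtain ⟨t, ht⟩ : (4 : ℤ) ∣ k * (((d : ℤ) - 1) * ((d' : ℤ) - 1)) := by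
    apply (ZMod.intCast_zmod_eq_zero_iff_dvd _ 4).1
    push_cast
    exact hz _ _ _ h1 h2
  have h4 : Complex.I ^ (4 * t) = 1 := by
    rw [zpow_mul, show (4 : ℤ) = ((4 : ℕ) : ℤ) by norm_num, zpow_natCast, Complex.I_pow_four,
      one_zpow]
  rw [chi, chi, chi, ← zpow_add₀ Complex.I_ne_zero, ← one_mul (_ ^ (_ + _)), ← h4,
    ← zpow_add₀ Complex.I_ne_zero, ← ht]
  congr 1
  push_cast
  ring

/-! ### Sums over residue classes -/

/-- On `ZMod d`, translations and multiplications by units are permutations of the index set; this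
gives the two invariance lemmas below. -/
theorem sum_range_eq_sum_zmod (d : ℕ) [NeZero d] (H : ℤ → ℂ) :
    ∑ b ∈ Finset.range d, H b = ∑ x : ZMod d, H (x.val : ℤ) := by
  refine Finset.sum_nbij' (fun b => (b : ZMod d)) (fun x => x.val) ?_ ?_ ?_ ?_ ?_
  · simp
  · intro x _
    simpa using ZMod.val_lt x
  · intro b hb
    exact ZMod.val_cast_of_lt (Finset.mem_range.1 hb)
  · intro x _
    exact ZMod.natCast_zmod_val x
  · intro b hb
    simp only [ZMod.val_cast_of_lt (Finset.mem_range.1 hb)]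

theorem periodic_eq_of_intCast_eq {d : ℕ} {H : ℤ → ℂ} (hH : Function.Periodic H d) {x y : ℤ}
    (h : (x : ZMod d) = y) : H x = H y := by
  obtain ⟨t, ht⟩ := (ZMod.intCast_eq_intCast_iff_dvd_sub _ _ _).1 h
  have := hH.int_mul t x
  rw [← this]
  congr 1
  linear_combination -ht

theorem sum_range_add_of_periodic {d : ℕ} (hd : 0 < d) {H : ℤ → ℂ} (hH : Function.Periodic H d)
    (s : ℤ) : ∑ b ∈ Finset.range d, H (b + s) = ∑ b ∈ Finset.range d, H b := by
  have : NeZero d := ⟨hd.ne'⟩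
  rw [sum_range_eq_sum_zmod d H,
    sum_range_eq_sum_zmod d fun b => H (b + s),
    ← Equiv.sum_comp (Equiv.addRight (s : ZMod d)) fun x : ZMod d => H x.val]
  refine Finset.sum_congr rfl fun x _ => periodic_eq_of_intCast_eq hH ?_
  simp

theorem sum_range_mul_of_coprime {d a : ℕ} (hd : 0 < d) (ha : a.Coprime d) {H : ℤ → ℂ}
    (hH : Function.Periodic H d) :
    ∑ b ∈ Finset.range d, H (a * b) = ∑ b ∈ Finset.range d, H b := by
  have : NeZero d := ⟨hd.ne'⟩
  rw [sum_range_eq_sum_zmod d H,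
    sum_range_eq_sum_zmod d fun b => H (a * b),
    ← Equiv.sum_comp (ZMod.unitOfCoprime a ha).mulLeft fun x : ZMod d => H x.val]
  refine Finset.sum_congr rfl fun x _ => periodic_eq_of_intCast_eq hH ?_
  simp

theorem sum_range_mul_of_periodic {d : ℕ} (g : ℕ) {H : ℤ → ℂ} (hH : Function.Periodic H d) :
    ∑ b ∈ Finset.range (g * d), H b = g * ∑ b ∈ Finset.range d, H b := by
  induction g with
  | zero => simp
  | succ g ih =>
    rw [add_mul, one_mul, Finset.sum_range_add, ih]
    push_cast
    rw [add_mul, one_mul]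
    congr 1
    refine Finset.sum_congr rfl fun x _ => ?_
    rw [add_comm]
    exact hH.nat_mul g x

theorem sum_range_mul (d d' : ℕ) (θ : ℤ → ℂ) :
    ∑ t ∈ Finset.range (d * d'), θ t =
      ∑ b ∈ Finset.range d, ∑ b' ∈ Finset.range d', θ (b + d * b') := by
  rw [Finset.sum_comm]
  induction d' with
  | zero => simp
  | succ n ih =>
    rw [mul_add, mul_one, Finset.sum_range_add, Finset.sum_range_succ, ih]
    push_cast
    simp only [add_comm]

/-- If `ψ` has period `d d'`, then the values of `a b + d b'`, for `b` mod `d` and `b'` mod `d'`,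
are the multiples of `g = (a, d)`, each taken `g` times. -/
theorem sum_sum_range_eq_gcd_mul {a d d' : ℕ} (ha : 0 < a) (hd : 0 < d) (hd' : 0 < d')
    {ψ : ℤ → ℂ} (hψ : Function.Periodic ψ (d * d' : ℕ)) :
    ∑ b ∈ Finset.range d, ∑ b' ∈ Finset.range d', ψ (a * b + d * b') =
      (Nat.gcd a d : ℂ) * ∑ t ∈ Finset.range (d * d' / Nat.gcd a d), ψ (Nat.gcd a d * t) := by
  obtain ⟨a₁, d₁, hco, ha₁, hd₁⟩ := Nat.exists_coprime a d
  have hg : 0 < Nat.gcd a d := Nat.gcd_pos_of_pos_left _ ha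
  set g := Nat.gcd a d with hgdef
  clear_value g
  subst ha₁ hd₁
  have hd₁ : 0 < d₁ := Nat.pos_of_mul_pos_right hd
  set θ : ℤ → ℂ := fun s => ψ (g * s) with hθ
  have hθp : Function.Periodic θ (d₁ * d' : ℕ) := by
    intro x
    simp only [hθ]
    rw [← hψ (g * x)]
    congr 1
    push_cast
    ring
  -- `H` has period `d₁`, because `x ↦ x + d₁` only shifts `b'` by 1. So the sum over `b` modulo `g
  -- d₁` consists of `g` sums over residues modulo `d₁`, which the unit `a₁` permutes.
  set H : ℤ → ℂ := fun x => ∑ b' ∈ Finset.range d', θ (x + d₁ * b') with hH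
  have hHp : Function.Periodic H d₁ := by
    intro x
    have hper : Function.Periodic (fun b' : ℤ => θ (x + d₁ * b')) d' := by
      intro b'
      simp only
      rw [← hθp (x + d₁ * b')]
      congr 1
      push_cast
      ring
    have h := sum_range_add_of_periodic hd' hper 1
    simp only [hH]
    rw [← h]
    refine Finset.sum_congr rfl fun b _ => ?_
    congr 1
    ring
  have hHp' : Function.Periodic (fun b : ℤ => H (a₁ * b)) d₁ := by
    intro x
    simp only [mul_add]
    exact hHp.nat_mul a₁ (a₁ * x)
  have h1 : d₁ * g * d' / g = d₁ * d' := by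
    rw [mul_right_comm, Nat.mul_div_cancel _ hg]
  rw [h1, show ∑ t ∈ Finset.range (d₁ * d'), ψ (g * t) = ∑ t ∈ Finset.range (d₁ * d'), θ t from rfl,
    sum_range_mul, mul_comm d₁ g]
  trans ∑ b ∈ Finset.range (g * d₁), H (a₁ * b)
  · refine Finset.sum_congr rfl fun b _ => Finset.sum_congr rfl fun b' _ => ?_
    simp only [hθ]
    congr 1
    push_cast
    ring
  · rw [sum_range_mul_of_periodic g hHp', sum_range_mul_of_coprime hd₁ hco hHp]

/-! ### Pairs of factorizations -/

/-- The pairs of factorizations `a d = m`, `a' d' = n` with `(a', d) = g` correspond to the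
factorizations of `m n / g²`. -/
theorem sum_divisorsAntidiagonal_mul {m n : ℕ} (hm : 0 < m) (hn : 0 < n) (G : ℕ → ℕ → ℕ → ℂ) :
    ∑ p ∈ m.divisorsAntidiagonal, ∑ q ∈ n.divisorsAntidiagonal,
        G (Nat.gcd q.1 p.2) (p.1 * q.1 / Nat.gcd q.1 p.2) (p.2 * q.2 / Nat.gcd q.1 p.2) =
      ∑ g ∈ (Nat.gcd m n).divisors, ∑ r ∈ (m * n / g ^ 2).divisorsAntidiagonal, G g r.1 r.2 := by
  rw [← Finset.sum_product', Finset.sum_sigma']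
  refine Finset.sum_nbij'
    (i := fun x => ⟨Nat.gcd x.2.1 x.1.2, (x.1.1 * x.2.1 / Nat.gcd x.2.1 x.1.2,
      x.1.2 * x.2.2 / Nat.gcd x.2.1 x.1.2)⟩)
    -- With `a' = xg`, `d = yg` and `(x, y) = 1`, the image is `α = ax`, `δ = yd'`, while `m/g =
    -- ay`. Hence `a = (α, m/g)`, and then `d = m/a`, `a' = gα/a`, `d' = n/a'`.
    (j := fun y => ((Nat.gcd y.2.1 (m / y.1), m / Nat.gcd y.2.1 (m / y.1)),
      (y.1 * y.2.1 / Nat.gcd y.2.1 (m / y.1), n / (y.1 * y.2.1 / Nat.gcd y.2.1 (m / y.1)))))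
    ?_ ?_ ?_ ?_ ?_
  case refine_1 | refine_3 =>
    rintro ⟨⟨a, d⟩, ⟨a', d'⟩⟩ h
    simp only [Finset.mem_product, Nat.mem_divisorsAntidiagonal] at h
    obtain ⟨⟨rfl, -⟩, ⟨rfl, -⟩⟩ := h
    have ha : 0 < a := Nat.pos_of_mul_pos_right hm
    have hd : 0 < d := Nat.pos_of_mul_pos_left hm
    have ha' : 0 < a' := Nat.pos_of_mul_pos_right hn
    have hd' : 0 < d' := Nat.pos_of_mul_pos_left hn
    obtain ⟨x, y, hco, hx, hy⟩ := Nat.exists_coprime a' d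
    have hg : 0 < Nat.gcd a' d := Nat.gcd_pos_of_pos_left _ ha'
    set g := Nat.gcd a' d with hgdef
    clear_value g
    subst hx hy
    have hx : 0 < x := Nat.pos_of_mul_pos_right ha'
    have e1 : a * (x * g) / g = a * x := by rw [← mul_assoc, Nat.mul_div_cancel _ hg]
    have e2 : y * g * d' / g = y * d' := by rw [mul_right_comm, Nat.mul_div_cancel _ hg]
    have e3 : a * (y * g) * (x * g * d') / g ^ 2 = a * x * (y * d') := by
      rw [show a * (y * g) * (x * g * d') = a * x * (y * d') * g ^ 2 by ring,
        Nat.mul_div_cancel _ (pow_pos hg 2)]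
    first
    | simp only [Finset.mem_sigma, Nat.mem_divisors, Nat.mem_divisorsAntidiagonal, e1, e2, e3]
      refine ⟨⟨Nat.dvd_gcd ⟨a * y, by ring⟩ ⟨x * d', by ring⟩, (Nat.gcd_pos_of_pos_left _ hm).ne'⟩,
        by trivial, ?_⟩
      have hy : 0 < y := Nat.pos_of_mul_pos_right hd
      positivity
    | have e4 : a * (y * g) / g = a * y := by rw [← mul_assoc, Nat.mul_div_cancel _ hg]
      have e5 : Nat.gcd (a * x) (a * y) = a := by rw [Nat.gcd_mul_left, hco.gcd_eq_one, mul_one]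
      have e6 : a * (y * g) / a = y * g := Nat.mul_div_cancel_left _ ha
      have e7 : g * (a * x) / a = x * g := by
        rw [show g * (a * x) = a * (x * g) by ring, Nat.mul_div_cancel_left _ ha]
      have e8 : x * g * d' / (x * g) = d' := Nat.mul_div_cancel_left _ ha'
      simp only [e1, e4, e5, e6, e7, e8]
  case refine_2 | refine_4 =>
    rintro ⟨g, ⟨α, δ⟩⟩ h
    simp only [Finset.mem_sigma, Nat.mem_divisors, Nat.mem_divisorsAntidiagonal] at h
    obtain ⟨⟨hg, -⟩, hαδ, -⟩ := h
    obtain ⟨m₁, rfl⟩ := hg.trans (Nat.gcd_dvd_left _ _)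
    obtain ⟨n₁, rfl⟩ := hg.trans (Nat.gcd_dvd_right _ _)
    clear hg
    have hg : 0 < g := Nat.pos_of_mul_pos_right hm
    have hm₁ : 0 < m₁ := Nat.pos_of_mul_pos_left hm
    have hn₁ : 0 < n₁ := Nat.pos_of_mul_pos_left hn
    rw [show g * m₁ * (g * n₁) = m₁ * n₁ * g ^ 2 by ring, Nat.mul_div_cancel _ (pow_pos hg 2)]
      at hαδ
    have hα : 0 < α := Nat.pos_of_mul_pos_right (hαδ ▸ Nat.mul_pos hm₁ hn₁)
    obtain ⟨x, y, hco, hx, hy⟩ := Nat.exists_coprime α m₁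
    have ha : 0 < Nat.gcd α m₁ := Nat.gcd_pos_of_pos_left _ hα
    have e1 : g * m₁ / g = m₁ := Nat.mul_div_cancel_left _ hg
    set a := Nat.gcd α m₁ with hadef
    clear_value a
    subst hx hy
    have hx : 0 < x := Nat.pos_of_mul_pos_right hα
    have hxy : x * δ = y * n₁ := Nat.eq_of_mul_eq_mul_left ha (by linarith)
    obtain ⟨t, rfl⟩ : x ∣ n₁ := hco.dvd_of_dvd_mul_left ⟨δ, hxy.symm⟩
    obtain rfl : δ = y * t := Nat.eq_of_mul_eq_mul_left hx (by rw [hxy]; ring)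
    have e2 : g * (y * a) / a = g * y := by rw [← mul_assoc, Nat.mul_div_cancel _ ha]
    have e3 : g * (x * a) / a = g * x := by rw [← mul_assoc, Nat.mul_div_cancel _ ha]
    have e4 : g * (x * t) / (g * x) = t := by
      rw [← mul_assoc, Nat.mul_div_cancel_left _ (Nat.mul_pos hg hx)]
    first
    | simp only [Finset.mem_product, Nat.mem_divisorsAntidiagonal, e1, ← hadef, e2, e3, e4]
      exact ⟨⟨by ring, hm.ne'⟩, ⟨by ring, hn.ne'⟩⟩
    | have e5 : Nat.gcd (g * x) (g * y) = g := by rw [Nat.gcd_mul_left, hco.gcd_eq_one, mul_one]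
      have e6 : a * (g * x) / g = x * a := by
        rw [show a * (g * x) = g * (x * a) by ring, Nat.mul_div_cancel_left _ hg]
      have e7 : g * y * t / g = y * t := by rw [mul_assoc, Nat.mul_div_cancel_left _ hg]
      simp only [e1, ← hadef, e2, e3, e4, e5, e6, e7]
  case refine_5 => exact fun _ _ => rfl

/-! ### Composition of Hecke operators -/

/-- The action of the matrix `(a, b; 0, d)` on a function `F`, twisted by `χ_k(d) ξ^(-b d)`. -/
noncomputable def triangularSlash (k : ℤ) (F : ℂ → ℂ) (a d : ℕ) (b : ℤ) (w : ℂ) : ℂ :=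
  chi k d * (e ((k : ℝ) / 12) ^ (-(b * d)) * F ((a * w + b) / d))

theorem triangularSlash_eq (k : ℤ) (F : ℂ → ℂ) (a d : ℕ) (b : ℤ) (w : ℂ) :
    triangularSlash k F a d b w =
      chi k d * (e (-(k * (b * d) / 12)) * F ((a * w + b) / d)) := by
  rw [triangularSlash, e_zpow]
  congr 3
  push_cast
  ring

theorem hecke_apply (k : ℤ) (m : ℕ) (f : ℍ → ℂ) (z : ℍ) :
    hecke k m f z = 1 / (Real.sqrt m : ℂ) * ∑ p ∈ m.divisorsAntidiagonal,
      ∑ b ∈ Finset.range p.2, triangularSlash k (f ∘ UpperHalfPlane.ofComplex) p.1 p.2 b z := by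
  simp only [hecke, triangularSlash, Finset.mul_sum, Function.comp_apply, Int.cast_natCast]

theorem im_triangular_pos {a d : ℕ} (ha : 0 < a) (hd : 0 < d) (b : ℤ) {w : ℂ} (hw : 0 < w.im) :
    0 < ((a * w + b) / d : ℂ).im := by
  have : ((a * w + b) / d : ℂ).im = a * w.im / d := by
    rw [Complex.div_natCast_im]
    simp
  rw [this]
  positivity

/-- Replacing `b` by `b + d` moves the argument of `F` by 1, which contributes `ξ`, and changes the
twist by `ξ^(-d²)`; these cancel as `k d² ≡ k` mod 12. -/
theorem triangularSlash_periodic {k : ℤ} {F : ℂ → ℂ}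
    (hF : ∀ w : ℂ, 0 < w.im → F (w + 1) = e (k / 12) * F w) {a d : ℕ} (ha : 0 < a) (hd : 0 < d)
    (hdk : k * (d : ℤ) ^ 2 ≡ k [ZMOD 12]) {w : ℂ} (hw : 0 < w.im) :
    Function.Periodic (fun b => triangularSlash k F a d b w) d := by
  intro b
  obtain ⟨t, ht⟩ := twelve_dvd_mul_sq_sub_one hdk
  have hd0 : (d : ℂ) ≠ 0 := by exact_mod_cast hd.ne'
  have h1 : ((a * w + (b + d : ℤ)) / d : ℂ) = (a * w + b) / d + 1 := by
    push_cast
    field_simp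
    ring
  simp only [triangularSlash_eq]
  rw [h1, hF _ (im_triangular_pos ha hd b hw), ← mul_assoc (e _) (e _), ← e_add]
  congr 2
  refine e_eq_e_of_sub_eq_int (-t) ?_
  have ht' : (k : ℝ) * ((d : ℝ) ^ 2 - 1) = 12 * t := by exact_mod_cast ht
  push_cast
  linear_combination (-1 / 12 : ℝ) * ht'

/-- A common factor `g` does not change the point, and the exponent of `ξ` changes by a multiple of
`g² - 1`, which is harmless; only `χ_k(g)` is left. -/
theorem triangularSlash_scale {k : ℤ} (F : ℂ → ℂ) {g a d : ℕ} (hg : 0 < g)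
    (hgk : k * (g : ℤ) ^ 2 ≡ k [ZMOD 12]) (hdk : k * (d : ℤ) ^ 2 ≡ k [ZMOD 12]) (b : ℤ) (w : ℂ) :
    triangularSlash k F (g * a) (g * d) (g * b) w = chi k g * triangularSlash k F a d b w := by
  obtain ⟨t, ht⟩ := twelve_dvd_mul_sq_sub_one hgk
  have hg0 : (g : ℂ) ≠ 0 := by exact_mod_cast hg.ne'
  have h1 : (((g * a : ℕ) : ℂ) * w + ((g * b : ℤ) : ℂ)) / ((g * d : ℕ) : ℂ) =
      (a * w + b) / d := by
    push_cast
    rw [mul_assoc, ← mul_add, mul_div_mul_left _ _ hg0]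
  rw [triangularSlash_eq, triangularSlash_eq, h1, chi_mul hgk hdk, mul_assoc]
  congr 3
  refine e_eq_e_of_sub_eq_int (-t * (b * d)) ?_
  have ht' : (k : ℝ) * ((g : ℝ) ^ 2 - 1) = 12 * t := by exact_mod_cast ht
  push_cast
  linear_combination (-1 / 12 : ℝ) * (b * d) * ht'

/-- The exponents of the twists differ by `k(a'd' - 1)bd/12 + k(d² - 1)b'd'/12`, an integer. -/
theorem triangularSlash_comp {k : ℤ} (F : ℂ → ℂ) {a d a' d' : ℕ} (hd : 0 < d)
    (hdk : k * (d : ℤ) ^ 2 ≡ k [ZMOD 12]) (hdk' : k * (d' : ℤ) ^ 2 ≡ k [ZMOD 12])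
    (hn : k * (a' * d' : ℕ) ≡ k [ZMOD 12]) (b b' : ℤ) (w : ℂ) :
    triangularSlash k (triangularSlash k F a' d' b') a d b w =
      triangularSlash k F (a * a') (d * d') (a' * b + d * b') w := by
  obtain ⟨t, ht⟩ := twelve_dvd_mul_sq_sub_one hdk
  obtain ⟨s, hs⟩ := twelve_dvd hn
  have hd0 : (d : ℂ) ≠ 0 := by exact_mod_cast hd.ne'
  have h1 : (a' * ((a * w + b) / d) + b') / d' =
      (((a * a' : ℕ) : ℂ) * w + ((a' * b + d * b' : ℤ) : ℂ)) / ((d * d' : ℕ) : ℂ) := by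
    push_cast
    rw [← div_div]
    congr 1
    field_simp
    ring
  have h2 : e (-(k * (b * d) / 12)) * e (-(k * (b' * d') / 12)) =
      e (-(k * ((a' * b + d * b' : ℤ) * (d * d' : ℕ)) / 12)) := by
    rw [← e_add]
    refine e_eq_e_of_sub_eq_int (s * (b * d) + t * (b' * d')) ?_
    have ht' : (k : ℝ) * ((d : ℝ) ^ 2 - 1) = 12 * t := by exact_mod_cast ht
    have hs' : (k : ℝ) * ((a' * d' : ℝ) - 1) = 12 * s := by exact_mod_cast hs
    push_cast
    linear_combination (1 / 12 : ℝ) * (b * d) * hs' + (1 / 12 : ℝ) * (b' * d') * ht'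
  simp only [triangularSlash_eq]
  rw [h1, chi_mul hdk hdk', ← h2]
  ring

theorem sum_sum_triangularSlash {k : ℤ} {F : ℂ → ℂ}
    (hF : ∀ w : ℂ, 0 < w.im → F (w + 1) = e (k / 12) * F w) {a d a' d' : ℕ}
    (hm : 0 < a * d) (hn : 0 < a' * d') (hmk : k * (a * d : ℕ) ≡ k [ZMOD 12])
    (hnk : k * (a' * d' : ℕ) ≡ k [ZMOD 12]) {w : ℂ} (hw : 0 < w.im) :
    ∑ b ∈ Finset.range d, ∑ b' ∈ Finset.range d',
        triangularSlash k (triangularSlash k F a' d' b') a d b w =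
      Nat.gcd a' d * (chi k (Nat.gcd a' d) * ∑ t ∈ Finset.range (d * d' / Nat.gcd a' d),
        triangularSlash k F (a * a' / Nat.gcd a' d) (d * d' / Nat.gcd a' d) t w) := by
  have ha : 0 < a := Nat.pos_of_mul_pos_right hm
  have hd : 0 < d := Nat.pos_of_mul_pos_left hm
  have ha' : 0 < a' := Nat.pos_of_mul_pos_right hn
  have hd' : 0 < d' := Nat.pos_of_mul_pos_left hn
  have hdk := mul_sq_modEq hmk (Dvd.intro_left a rfl)
  have hdk' := mul_sq_modEq hnk (Dvd.intro_left a' rfl)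
  have hg : 0 < Nat.gcd a' d := Nat.gcd_pos_of_pos_left _ ha'
  have hgk := mul_sq_modEq hmk ((Nat.gcd_dvd_right a' d).trans (Dvd.intro_left a rfl))
  have hddk : k * ((d * d' : ℕ) : ℤ) ^ 2 ≡ k [ZMOD 12] := by
    push_cast
    rw [mul_pow, ← mul_assoc]
    exact (hdk.mul_right _).trans hdk'
  obtain ⟨D, hD⟩ : Nat.gcd a' d ∣ d * d' := (Nat.gcd_dvd_right a' d).mul_right d'
  obtain ⟨A, hA⟩ : Nat.gcd a' d ∣ a * a' := (Nat.gcd_dvd_left a' d).mul_left a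
  -- Here `D` is `dd'/g`. No division modulo 12 is needed: `k D² ≡ k g² D² = k (dd')² ≡ k`.
  have hDk : k * (D : ℤ) ^ 2 ≡ k [ZMOD 12] := by
    have h : k * ((D : ℤ) ^ 2 * (Nat.gcd a' d : ℤ) ^ 2) ≡ k [ZMOD 12] := by
      rw [← mul_pow, mul_comm (D : ℤ)]
      exact_mod_cast hD ▸ hddk
    calc k * (D : ℤ) ^ 2 ≡ k * (Nat.gcd a' d : ℤ) ^ 2 * (D : ℤ) ^ 2 [ZMOD 12] :=
          (hgk.mul_right _).symm
      _ ≡ k [ZMOD 12] := by convert h using 1; ring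
  simp only [triangularSlash_comp F hd hdk hdk' hnk]
  rw [sum_sum_range_eq_gcd_mul ha' hd hd'
    (triangularSlash_periodic hF (Nat.mul_pos ha ha') (Nat.mul_pos hd hd') hddk hw)]
  congr 1
  rw [hD, hA, Nat.mul_div_cancel_left _ hg, Nat.mul_div_cancel_left _ hg, Finset.mul_sum]
  exact Finset.sum_congr rfl fun t _ => triangularSlash_scale F hg hgk hDk t w

theorem sq_dvd_mul_of_dvd_gcd {m n d : ℕ} (hd : d ∣ Nat.gcd m n) : d ^ 2 ∣ m * n := by
  rw [sq]
  exact Nat.mul_dvd_mul (hd.trans (Nat.gcd_dvd_left _ _)) (hd.trans (Nat.gcd_dvd_right _ _))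

theorem mul_div_sq_modEq {k : ℤ} {m n d : ℕ} (hd0 : 0 < d) (hm : k * m ≡ k [ZMOD 12])
    (hn : k * n ≡ k [ZMOD 12]) (hd : d ∣ Nat.gcd m n) :
    k * (m * n / d ^ 2 : ℕ) ≡ k [ZMOD 12] := by
  obtain ⟨t, ht⟩ := twelve_mul_sq_dvd hm hn hd
  obtain ⟨q, hq⟩ : d ^ 2 ∣ m * n := sq_dvd_mul_of_dvd_gcd hd
  rw [hq, Nat.mul_div_cancel_left _ (pow_pos hd0 2)]
  have hq' : (m : ℤ) * n = d ^ 2 * q := by exact_mod_cast hq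
  have hd2 : (d : ℤ) ^ 2 ≠ 0 := by positivity
  rw [hq'] at ht
  refine (Int.modEq_iff_dvd.2 ⟨t, mul_left_cancel₀ hd2 ?_⟩).symm
  linear_combination ht

/-- Composition of Hecke operators on functions `f` with `f(z + 1) = ξ f(z)`. -/
theorem hecke_hecke {k : ℤ} {f : ℍ → ℂ}
    (hf : ∀ w : ℂ, 0 < w.im →
      f (UpperHalfPlane.ofComplex (w + 1)) = e (k / 12) * f (UpperHalfPlane.ofComplex w))
    {m n : ℕ} (hm : 0 < m) (hn : 0 < n) (hmk : k * m ≡ k [ZMOD 12]) (hnk : k * n ≡ k [ZMOD 12])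
    (z : ℍ) :
    hecke k m (hecke k n f) z =
      ∑ d ∈ (Nat.gcd m n).divisors, chi k d * hecke k (m * n / d ^ 2) f z := by
  set F : ℂ → ℂ := f ∘ UpperHalfPlane.ofComplex with hFdef
  -- The multiplicity `g` of each matrix is exactly what turns `(mn)^(-1/2)` into the normalization
  -- `(mn/g²)^(-1/2)`.
  have hsqrt : ∀ g ∈ (Nat.gcd m n).divisors, 1 / (Real.sqrt ((m * n / g ^ 2 : ℕ) : ℝ) : ℂ) =
      1 / (Real.sqrt m : ℂ) * (1 / (Real.sqrt n : ℂ)) * g := by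
    intro g hg
    obtain ⟨hg, -⟩ := Nat.mem_divisors.1 hg
    have hg0 : 0 < g := Nat.pos_of_dvd_of_pos hg (Nat.gcd_pos_of_pos_left _ hm)
    have hgR : (g : ℝ) ≠ 0 := by exact_mod_cast hg0.ne'
    have h2 : g ^ 2 ∣ m * n := sq_dvd_mul_of_dvd_gcd hg
    rw [Nat.cast_div h2 (by push_cast; positivity)]
    push_cast
    rw [Real.sqrt_div (by positivity), Real.sqrt_mul (by positivity),
      Real.sqrt_sq (by positivity)]
    push_cast
    have hm' : (Real.sqrt m : ℂ) ≠ 0 := by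
      exact_mod_cast (Real.sqrt_pos.2 (by exact_mod_cast hm)).ne'
    have hn' : (Real.sqrt n : ℂ) ≠ 0 := by
      exact_mod_cast (Real.sqrt_pos.2 (by exact_mod_cast hn)).ne'
    field_simp
  have key := sum_divisorsAntidiagonal_mul hm hn
    (fun g a d => g * (chi k g * ∑ t ∈ Finset.range d, triangularSlash k F a d t z))
  have hinner : ∀ p ∈ m.divisorsAntidiagonal, ∀ b : ℕ,
      triangularSlash k (hecke k n f ∘ UpperHalfPlane.ofComplex) p.1 p.2 b z =
        1 / (Real.sqrt n : ℂ) * ∑ q ∈ n.divisorsAntidiagonal, ∑ b' ∈ Finset.range q.2,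
          triangularSlash k (triangularSlash k F q.1 q.2 b') p.1 p.2 b z := by
    intro p hp b
    obtain ⟨hp, -⟩ := Nat.mem_divisorsAntidiagonal.1 hp
    have hpos : 0 < p.1 * p.2 := hp ▸ hm
    -- `UpperHalfPlane.ofComplex` is faithful only on the upper half-plane, so the inner operator
    -- may be expanded only at points known to lie there.
    have him := im_triangular_pos (Nat.pos_of_mul_pos_right hpos) (Nat.pos_of_mul_pos_left hpos) b
      z.coe_im_pos
    rw [triangularSlash, Function.comp_apply, hecke_apply,
      UpperHalfPlane.ofComplex_apply_of_im_pos him]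
    simp only [triangularSlash_eq k (triangularSlash k F _ _ _), e_zpow, Finset.mul_sum]
    refine Finset.sum_congr rfl fun q _ => Finset.sum_congr rfl fun b' _ => ?_
    rw [show ((-((b : ℤ) * p.2) : ℤ) : ℝ) * ((k : ℝ) / 12) =
      -(k * (((b : ℤ) : ℝ) * p.2) / 12) by push_cast; ring]
    ring
  have hstep : ∀ p ∈ m.divisorsAntidiagonal, ∀ q ∈ n.divisorsAntidiagonal,
      ∑ b ∈ Finset.range p.2, ∑ b' ∈ Finset.range q.2,
          triangularSlash k (triangularSlash k F q.1 q.2 b') p.1 p.2 b z =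
        Nat.gcd q.1 p.2 * (chi k (Nat.gcd q.1 p.2) *
          ∑ t ∈ Finset.range (p.2 * q.2 / Nat.gcd q.1 p.2), triangularSlash k F
            (p.1 * q.1 / Nat.gcd q.1 p.2) (p.2 * q.2 / Nat.gcd q.1 p.2) t z) := by
    intro p hp q hq
    obtain ⟨rfl, -⟩ := Nat.mem_divisorsAntidiagonal.1 hp
    obtain ⟨rfl, -⟩ := Nat.mem_divisorsAntidiagonal.1 hq
    exact sum_sum_triangularSlash hf hm hn hmk hnk z.coe_im_pos
  calc hecke k m (hecke k n f) z
      = 1 / (Real.sqrt m : ℂ) * (1 / (Real.sqrt n : ℂ)) * ∑ p ∈ m.divisorsAntidiagonal,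
          ∑ q ∈ n.divisorsAntidiagonal, ∑ b ∈ Finset.range p.2, ∑ b' ∈ Finset.range q.2,
            triangularSlash k (triangularSlash k F q.1 q.2 b') p.1 p.2 b z := by
        rw [hecke_apply, mul_assoc, Finset.mul_sum (a := 1 / (Real.sqrt n : ℂ))]
        congr 1
        refine Finset.sum_congr rfl fun p hp => ?_
        rw [Finset.sum_comm, Finset.mul_sum]
        exact Finset.sum_congr rfl fun b _ => hinner p hp b
    _ = 1 / (Real.sqrt m : ℂ) * (1 / (Real.sqrt n : ℂ)) * ∑ g ∈ (Nat.gcd m n).divisors,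
          ∑ r ∈ (m * n / g ^ 2).divisorsAntidiagonal,
            g * (chi k g * ∑ t ∈ Finset.range r.2, triangularSlash k F r.1 r.2 t z) := by
        rw [← key]
        congr 1
        exact Finset.sum_congr rfl fun p hp => Finset.sum_congr rfl fun q hq => hstep p hp q hq
    _ = _ := by
        rw [Finset.mul_sum]
        refine Finset.sum_congr rfl fun g hg => ?_
        rw [hecke_apply, hsqrt g hg]
        simp only [Finset.mul_sum]
        refine Finset.sum_congr rfl fun r _ => Finset.sum_congr rfl fun t _ => ?_
        ring

/-! ### Whittaker's function does not vanish identically -/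

/-- The regularized series is entire with constant term `1/Γ(c)`. -/
theorem tendsto_kummer {a c : ℂ} (hc : Complex.Gamma c ≠ 0) :
    Filter.Tendsto (fun x : ℝ => kummer a c x) (nhds 0) (nhds 1) := by
  have hr : (Complex.regularizedHGFunSeries {a} {c}).radius = ⊤ :=
    Complex.radius_regularizedHGFunSeries_eq_top (by simp)
  have hp := (Complex.regularizedHGFunSeries {a} {c}).hasFPowerSeriesOnBall (by simp [hr])
  have h0 : kummer a c ((0 : ℝ) : ℂ) = 1 := by
    have h := hp.coeff_zero ![]
    rw [kummer, Complex.ofReal_zero, Complex.regularizedHGFun, ← h,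
      Complex.regularizedHGFunSeries]
    simp [Complex.regularizedHGFunCoeff, hc]
  have hcont : ContinuousAt (fun x : ℝ => kummer a c x) 0 := by
    have h : ContinuousAt (Complex.regularizedHGFunSeries {a} {c}).sum ((0 : ℝ) : ℂ) := by
      rw [Complex.ofReal_zero]
      exact hp.hasFPowerSeriesAt.continuousAt
    exact continuousAt_const.mul
      (h.comp (f := fun x : ℝ => (x : ℂ)) Complex.continuous_ofReal.continuousAt)
  simpa only [ContinuousAt, h0] using hcont

theorem gamma_ne_zero_of_im_ne_zero {s : ℂ} (hs : s.im ≠ 0) : Complex.Gamma s ≠ 0 :=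
  Complex.Gamma_ne_zero fun m h => hs (by simp [h])

/-- Near 0, `W` behaves like `x^(1/2) (A x^(iR) + B x^(-iR))` with `A ≠ 0`, and the two powers
oscillate independently. -/
theorem exists_whittakerW_ne_zero (κ R : ℝ) (hR : R ≠ 0) :
    ∃ x : ℝ, 0 < x ∧ whittakerW κ (Complex.I * R) x ≠ 0 := by
  by_contra! hW
  -- These are the imaginary parts of all Gamma arguments involved, `κ` being real. As
  -- `Complex.Gamma` takes the value 0 at its poles, nonvanishing is also what the denominators
  -- require.
  have hG : ∀ s : ℂ, s.im = R ∨ s.im = -R ∨ s.im = 2 * R ∨ s.im = -(2 * R) →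
      Complex.Gamma s ≠ 0 := by
    intro s hs
    apply gamma_ne_zero_of_im_ne_zero
    rcases hs with h | h | h | h <;> rw [h] <;> simpa using hR
  set μ : ℂ := Complex.I * R with hμ
  set A : ℂ := Complex.Gamma (-2 * μ) / Complex.Gamma (1 / 2 - μ - κ) with hA
  set B : ℂ := Complex.Gamma (2 * μ) / Complex.Gamma (1 / 2 + μ - κ) with hB
  have hA0 : A ≠ 0 := div_ne_zero (hG _ (by simp [hμ])) (hG _ (by simp [hμ]))
  set K₁ : ℝ → ℂ := fun x => kummer (1 / 2 + μ - κ) (1 + 2 * μ) x with hK₁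
  set K₂ : ℝ → ℂ := fun x => kummer (1 / 2 + -μ - κ) (1 + 2 * -μ) x with hK₂
  have hlim₁ : Filter.Tendsto K₁ (nhds 0) (nhds 1) := tendsto_kummer (hG _ (by simp [hμ]))
  have hlim₂ : Filter.Tendsto K₂ (nhds 0) (nhds 1) := tendsto_kummer (hG _ (by simp [hμ]))
  have hrel : ∀ t : ℝ, A * Complex.exp (Complex.I * R * t) * K₁ (Real.exp t) +
      B * Complex.exp (-(Complex.I * R * t)) * K₂ (Real.exp t) = 0 := by
    intro t
    have h := hW (Real.exp t) (Real.exp_pos t)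
    have hx : ((Real.exp t : ℝ) : ℂ) ≠ 0 := by exact_mod_cast (Real.exp_pos t).ne'
    have hpow : ∀ s : ℂ, ((Real.exp t : ℝ) : ℂ) ^ s = Complex.exp (s * t) := by
      intro s
      rw [Complex.cpow_def_of_ne_zero hx, ← Complex.ofReal_log (Real.exp_pos t).le, Real.log_exp,
        mul_comm]
    have h1 : Complex.exp (-((Real.exp t : ℝ) : ℂ) / 2) * Complex.exp (1 / 2 * t) ≠ 0 :=
      mul_ne_zero (Complex.exp_ne_zero _) (Complex.exp_ne_zero _)
    refine (mul_eq_zero.1 ?_).resolve_left h1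
    rw [whittakerW, whittakerM, whittakerM, hpow, hpow, add_mul, add_mul, Complex.exp_add,
      Complex.exp_add, neg_mul μ] at h
    rw [← h]
    ring
  have hkey : ∀ s : ℝ, A * Complex.exp (Complex.I * s) + B * Complex.exp (-(Complex.I * s)) = 0 := by
    intro s
    -- The steps `2π/|R|` are periods of `exp(iRt)`, so the oscillating factors stay equal to
    -- `exp(±is)` while `exp(t n) → 0` and both Kummer factors tend to 1.
    set t : ℕ → ℝ := fun n => -(n * (2 * Real.pi / |R|)) + s / R with ht
    have hpos : 0 < 2 * Real.pi / |R| := div_pos Real.two_pi_pos (abs_pos.2 hR)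
    have htlim : Filter.Tendsto (fun n => Real.exp (t n)) Filter.atTop (nhds 0) := by
      refine Real.tendsto_exp_atBot.comp (Filter.tendsto_atBot_add_const_right _ _ ?_)
      exact Filter.tendsto_neg_atTop_atBot.comp
        (Filter.Tendsto.atTop_mul_const hpos tendsto_natCast_atTop_atTop)
    have hexp : ∀ n, Complex.exp (Complex.I * R * t n) = Complex.exp (Complex.I * s) := by
      intro n
      obtain ⟨σ, hσ⟩ : ∃ σ : ℤ, R / |R| = σ := by
        rcases abs_cases R with h | h
        · exact ⟨1, by rw [h.1, div_self hR]; simp⟩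
        · exact ⟨-1, by rw [h.1, div_neg, div_self hR]; simp⟩
      rw [Complex.exp_eq_exp_iff_exists_int]
      refine ⟨-(n * σ), ?_⟩
      have : R * t n = s - n * σ * (2 * Real.pi) := by
        rw [← hσ, ht]
        field_simp
        ring
      rw [mul_assoc, ← Complex.ofReal_mul, this]
      push_cast
      ring
    have hl : Filter.Tendsto (fun n => A * Complex.exp (Complex.I * R * t n) * K₁ (Real.exp (t n)) +
        B * Complex.exp (-(Complex.I * R * t n)) * K₂ (Real.exp (t n))) Filter.atTop
        (nhds (A * Complex.exp (Complex.I * s) * 1 + B * Complex.exp (-(Complex.I * s)) * 1)) := by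
      simp only [Complex.exp_neg, hexp]
      exact ((hlim₁.comp htlim).const_mul _).add ((hlim₂.comp htlim).const_mul _)
    simp only [hrel, mul_one] at hl
    exact tendsto_nhds_unique hl tendsto_const_nhds
  -- The phases 0 and `π/2` give `A + B = 0` and `i(A - B) = 0`, hence `A = 0`.
  have h0 := hkey 0
  have h1 := hkey (Real.pi / 2)
  rw [mul_comm Complex.I, ← neg_mul] at h1
  push_cast at h1
  rw [Complex.exp_pi_div_two_mul_I, neg_mul, Complex.exp_neg, Complex.exp_pi_div_two_mul_I,
    Complex.inv_I] at h1
  simp only [Complex.ofReal_zero, mul_zero, neg_zero, Complex.exp_zero, mul_one] at h0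
  apply hA0
  linear_combination (1 / 2 : ℂ) * h0 - (Complex.I / 2) * h1 + (A - B) / 2 * Complex.I_sq

/-! ### Extraction of Fourier coefficients -/

theorem integral_e_int_mul (n : ℤ) : ∫ s in (0 : ℝ)..1, e (n * s) = if n = 0 then 1 else 0 := by
  split_ifs with hn
  · subst hn
    simp [e]
  · have hc : (2 * Real.pi * Complex.I * n : ℂ) ≠ 0 :=
      mul_ne_zero Complex.two_pi_I_ne_zero (by exact_mod_cast hn)
    have h1 : ∀ s : ℝ, e (n * s) = Complex.exp (2 * Real.pi * Complex.I * n * s) := by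
      intro s
      rw [e]
      push_cast
      ring_nf
    simp only [h1]
    rw [integral_exp_mul_complex hc, ← h1, ← h1, mul_one, mul_zero, e_int]
    simp [e]

/-- Every `e` has modulus 1, so convergence at `s = 0` already provides a summable bound uniform in
`s`, which allows integration term by term. -/
theorem continuous_and_hasSum_integral {a : ℤ → ℂ} {freq : ℤ → ℤ} {u : ℝ → ℂ}
    (h : ∀ s : ℝ, HasSum (fun j => a j * e (freq j * s)) (u s)) :
    Continuous u ∧ HasSum (fun j => if freq j = 0 then a j else 0) (∫ s in (0 : ℝ)..1, u s) := by
  have hnorm : ∀ j s, ‖a j * e (freq j * s)‖ ≤ ‖a j‖ := fun j s => by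
    rw [norm_mul, norm_e, mul_one]
  have hcont : ∀ j, Continuous fun s : ℝ => a j * e (freq j * s) := fun j =>
    continuous_const.mul (continuous_e.comp (continuous_const.mul continuous_id))
  have hsum : Summable fun j => ‖a j‖ := by
    have := (h 0).summable.norm
    simpa only [norm_mul, norm_e, mul_one] using this
  constructor
  · have : u = fun s => ∑' j, a j * e (freq j * s) := funext fun s => (h s).tsum_eq.symm
    rw [this]
    exact continuous_tsum hcont hsum hnorm
  · have := intervalIntegral.hasSum_integral_of_dominated_convergence (μ := volume) (a := 0) (b := 1)
      (fun j _ => ‖a j‖) (fun j => (hcont j).aestronglyMeasurable)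
      (fun j => Filter.Eventually.of_forall fun s _ => hnorm j s)
      (Filter.Eventually.of_forall fun s _ => hsum) intervalIntegrable_const
      (Filter.Eventually.of_forall fun s _ => h s)
    simpa only [intervalIntegral.integral_const_mul, integral_e_int_mul, mul_ite, mul_one,
      mul_zero] using this

/-- The factor of `fourierTerm` that depends on `y` only. -/
noncomputable def radialFactor (k : ℤ) (R : ℝ) (ν y : ℝ) : ℂ :=
  1 / (Real.sqrt |ν| : ℂ) *
    whittakerW ((k : ℂ) / 2 * (SignType.sign ν : ℝ)) (Complex.I * R) (4 * Real.pi * |ν| * y)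

theorem radialFactor_mul_div (k : ℤ) (R ν y : ℝ) {m : ℕ} (hm : 0 < m) :
    radialFactor k R (ν * m) (y / m) = 1 / (Real.sqrt m : ℂ) * radialFactor k R ν y := by
  have hmR : (0 : ℝ) < m := by exact_mod_cast hm
  rw [radialFactor, radialFactor, sign_mul, sign_pos hmR, mul_one, abs_mul, abs_of_pos hmR,
    Real.sqrt_mul (abs_nonneg ν),
    show 4 * Real.pi * (|ν| * m) * (y / m) = 4 * Real.pi * |ν| * y by field_simp]
  push_cast
  rw [← mul_assoc, one_div_mul_one_div, mul_comm (Real.sqrt m : ℂ)]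

theorem exists_radialFactor_ne_zero (k : ℤ) {R : ℝ} (hR : R ≠ 0) {ν : ℝ} (hν : ν ≠ 0) :
    ∃ y : ℝ, 0 < y ∧ radialFactor k R ν y ≠ 0 := by
  obtain ⟨x, hx, hW⟩ := exists_whittakerW_ne_zero ((k : ℝ) / 2 * (SignType.sign ν : ℝ)) R hR
  have hν' : 0 < |ν| := abs_pos.2 hν
  have hc : 0 < 4 * Real.pi * |ν| := by positivity
  refine ⟨x / (4 * Real.pi * |ν|), by positivity, ?_⟩
  rw [radialFactor, mul_div_cancel₀ _ hc.ne']
  refine mul_ne_zero (one_div_ne_zero ?_) ?_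
  · exact_mod_cast (Real.sqrt_pos.2 hν').ne'
  · convert hW using 2
    push_cast
    rfl

theorem hasSum_comp_ofComplex {k : ℤ} {R : ℝ} {f : ℍ → ℂ} {c : ℤ → ℂ}
    (hc : HasFourierExpansion k R f c) {w : ℂ} (hw : 0 < w.im) :
    HasSum (fun j : ℤ => c j * (radialFactor k R (j + k / 12) w.im *
      e (((j : ℝ) + (k : ℝ) / 12) * w.re))) (f (UpperHalfPlane.ofComplex w)) := by
  lift w to ℍ using hw
  rw [UpperHalfPlane.ofComplex_apply]
  exact hc w

/-- The Fourier expansion of `f | (a, b; 0, d)` on a horizontal line, relative to the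
frequency `k / 12`. -/
theorem hasSum_triangularSlash {k : ℤ} {R : ℝ} {f : ℍ → ℂ} {c : ℤ → ℂ}
    (hc : HasFourierExpansion k R f c) {a d m : ℕ} (hm : 0 < m) (hadm : a * d = m) (b : ℕ) {y : ℝ}
    (hy : 0 < y) (s : ℝ) :
    HasSum (fun j : ℤ => chi k d * (c j * radialFactor k R (j + k / 12) (a * y / d)) *
        e (((j + k / 12) / d - k * d / 12) * b) *
        e ((a * (a * (12 * j + k) - k * d) : ℤ) * s))
      (triangularSlash k (f ∘ UpperHalfPlane.ofComplex) a d b ⟨12 * m * s, y⟩ *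
        e (-(k * m * s))) := by
  subst hadm
  have ha : 0 < a := Nat.pos_of_mul_pos_right hm
  have hd : 0 < d := Nat.pos_of_mul_pos_left hm
  have hd0 : (d : ℝ) ≠ 0 := by exact_mod_cast hd.ne'
  have him := im_triangular_pos ha hd b (w := ⟨12 * (a * d : ℕ) * s, y⟩) hy
  -- On the line `x = 12ms` every frequency in `s` becomes the integer `a²(12j + k)`; the factor
  -- `e(-kms)` then moves the frequency `k/12` in `x` to 0.
  have h := (hasSum_comp_ofComplex hc him).mul_left (chi k d * e (-(k * (b * d) / 12)) *
    e (-(k * (a * d : ℕ) * s)))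
  have hre : ((a * (⟨12 * (a * d : ℕ) * s, y⟩ : ℂ) + (b : ℤ)) / d : ℂ).re =
      12 * a ^ 2 * s + b / d := by
    rw [Complex.div_natCast_re]
    simp
    field_simp
  have him' : ((a * (⟨12 * (a * d : ℕ) * s, y⟩ : ℂ) + (b : ℤ)) / d : ℂ).im = a * y / d := by
    rw [Complex.div_natCast_im]
    simp
  rw [hre, him'] at h
  have hval : triangularSlash k (f ∘ UpperHalfPlane.ofComplex) a d b ⟨12 * (a * d : ℕ) * s, y⟩ *
      e (-(k * (a * d : ℕ) * s)) = chi k d * e (-(k * (b * d) / 12)) * e (-(k * (a * d : ℕ) * s)) *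
        f (UpperHalfPlane.ofComplex ((a * ⟨12 * (a * d : ℕ) * s, y⟩ + (b : ℤ)) / d)) := by
    rw [triangularSlash_eq, Function.comp_apply, Int.cast_natCast (R := ℝ)]
    ring
  rw [hval]
  refine h.congr_fun fun j => ?_
  have : e (((j + k / 12) / d - k * d / 12) * b) *
      e ((a * (a * (12 * j + k) - k * d) : ℤ) * s) =
      e (-(k * (b * d) / 12)) * e (-(k * (a * d : ℕ) * s)) *
        e (((j : ℝ) + (k : ℝ) / 12) * (12 * a ^ 2 * s + b / d)) := by
    simp only [← e_add]
    congr 1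
    push_cast
    field_simp
    ring
  rw [mul_assoc, this]
  ring

/-- With `N = 12/(12, k)` one has `D(m - 1) = N · k(m - 1)/12`. So `a`, being prime to `D`, divides
`m - 1` as well as `m`. -/
theorem eq_one_of_dvd_index {k : ℤ} {m a : ℕ} (hm : k * m ≡ k [ZMOD 12])
    (hD : Int.gcd m (D k) = 1) (ha : a ∣ m) (h : (a : ℤ) ∣ index k m) : a = 1 := by
  have hg : ((Int.gcd 12 k : ℕ) : ℤ) ≠ 0 := by
    exact_mod_cast (Int.gcd_pos_of_ne_zero_left k (by norm_num)).ne'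
  obtain ⟨N, hN⟩ : ((Int.gcd 12 k : ℕ) : ℤ) ∣ 12 := Int.gcd_dvd_left ..
  have hk : k = Int.gcd 12 k * D k :=
    (Int.mul_ediv_cancel' (Int.gcd_dvd_right ..)).symm
  have hidx : k * ((m : ℤ) - 1) = 12 * index k m := (Int.mul_ediv_cancel' (twelve_dvd hm)).symm
  have hDN : D k * ((m : ℤ) - 1) = N * index k m := by
    apply mul_left_cancel₀ hg
    rw [← mul_assoc, ← hk, hidx, ← mul_assoc, ← hN]
  have ham : (a : ℤ) ∣ m := by exact_mod_cast ha
  have hcop : IsCoprime (a : ℤ) (D k) :=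
    (Int.isCoprime_iff_gcd_eq_one.2 hD).of_isCoprime_of_dvd_left ham
  have h1 : (a : ℤ) ∣ (m : ℤ) - 1 := hcop.dvd_of_dvd_mul_left (hDN ▸ h.mul_left N)
  have h2 : (a : ℤ) ∣ 1 := by simpa using dvd_sub ham h1
  exact_mod_cast Int.eq_one_of_dvd_one (by positivity) h2

theorem sum_integral_triangularSlash {k : ℤ} {R : ℝ} {f : ℍ → ℂ} {c : ℤ → ℂ}
    (hc : HasFourierExpansion k R f c) {m : ℕ} (hm : 0 < m) (hmk : k * m ≡ k [ZMOD 12])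
    (hD : Int.gcd m (D k) = 1) {a d : ℕ} (hadm : a * d = m) {y : ℝ} (hy : 0 < y) :
    ∑ b ∈ Finset.range d, ∫ s in (0 : ℝ)..1,
        triangularSlash k (f ∘ UpperHalfPlane.ofComplex) a d b ⟨12 * m * s, y⟩ * e (-(k * m * s)) =
      if a = 1 then m * (c (index k m) * radialFactor k R (k / 12 * m) (y / m)) else 0 := by
  have ha : 0 < a := Nat.pos_of_mul_pos_right (hadm ▸ hm)
  have hd : 0 < d := Nat.pos_of_mul_pos_left (hadm ▸ hm)
  have haR : (a : ℝ) ≠ 0 := by exact_mod_cast ha.ne'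
  have hdR : (d : ℝ) ≠ 0 := by exact_mod_cast hd.ne'
  have hidx : k * ((m : ℤ) - 1) = 12 * index k m := (Int.mul_ediv_cancel' (twelve_dvd hmk)).symm
  have hidxR : (k : ℝ) * (m - 1) = 12 * index k m := by exact_mod_cast hidx
  have hadR : (a : ℝ) * d = m := by exact_mod_cast hadm
  have hS := hasSum_sum (s := Finset.range d) fun b _ =>
    (continuous_and_hasSum_integral fun s => hasSum_triangularSlash hc hm hadm b hy s).2
  have hterm : ∀ j : ℤ, (∑ b ∈ Finset.range d,
      if (a * (a * (12 * j + k) - k * d) : ℤ) = 0 then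
        chi k d * (c j * radialFactor k R (j + k / 12) (a * y / d)) *
          e (((j + k / 12) / d - k * d / 12) * b) else 0) =
      if j = index k m then
        (if a = 1 then m * (c (index k m) * radialFactor k R (k / 12 * m) (y / m)) else 0)
      else 0 := by
    intro j
    by_cases hj : (a * (a * (12 * j + k) - k * d) : ℤ) = 0
    · simp only [hj, if_true]
      rw [← Finset.mul_sum]
      have hj' : (a : ℤ) * (12 * j + k) = k * d := by
        have := (mul_eq_zero.1 hj).resolve_left (by exact_mod_cast ha.ne')
        linarith
      have hjR : (a : ℝ) * (12 * j + k) = k * d := by exact_mod_cast hj'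
      -- At frequency zero `12j + k = kd/a`, so the ratio of the geometric sum over `b` no longer
      -- involves `j`.
      have hx : ((j : ℝ) + k / 12) / d - k * d / 12 = -(12 * index k m) / (12 * a) := by
        rw [← hidxR, ← hadR]
        field_simp
        linear_combination hjR
      have hpow : ∀ b : ℕ, e (((j + k / 12) / d - k * d / 12) * b) =
          e (-(12 * index k m) / (12 * a)) ^ b := by
        intro b
        rw [hx, e_pow, mul_comm]
      simp only [hpow]
      by_cases ha1 : a = 1
      · subst ha1
        obtain rfl : d = m := by rw [← hadm, one_mul]
        obtain rfl : j = index k d := by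
          push_cast at hj'
          linarith
        have hν : ((index k d : ℤ) : ℝ) + k / 12 = k / 12 * d := by linarith
        have h1 : e (-(12 * index k d) / (12 * (1 : ℕ))) = 1 := by
          rw [← e_int (-index k d)]
          congr 1
          push_cast
          ring
        rw [h1, hν, chi_eq_one hmk]
        simp only [one_pow, Finset.sum_const, Finset.card_range, nsmul_eq_mul, mul_one, if_true,
          Nat.cast_one, one_mul]
        ring
      · have hne : e (-(12 * index k m) / (12 * a)) ≠ 1 := by
          intro h
          obtain ⟨n, hn⟩ := exists_int_of_e_eq_one h
          refine ha1 (eq_one_of_dvd_index hmk hD (Dvd.intro d hadm) ⟨-n, ?_⟩)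
          rw [div_eq_iff (by positivity)] at hn
          have : ((index k m : ℤ) : ℝ) = a * -n := by linarith
          exact_mod_cast this
        -- The `d`-th power has exponent `j - k(d² - 1)/12`, an integer, so a ratio other than 1
        -- makes the geometric sum vanish.
        have hone : e (-(12 * index k m) / (12 * a)) ^ d = 1 := by
          obtain ⟨t, ht⟩ := twelve_dvd_mul_sq_sub_one (mul_sq_modEq hmk (Dvd.intro_left a hadm))
          have htR : (k : ℝ) * ((d : ℝ) ^ 2 - 1) = 12 * t := by exact_mod_cast ht
          rw [e_pow, ← e_int (j - t), ← hx]
          congr 1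
          push_cast
          field_simp
          linear_combination -htR
        rw [geom_sum_eq hne, hone, sub_self, zero_div, mul_zero, if_neg ha1, ite_self]
    · simp only [hj, if_false, Finset.sum_const_zero]
      split_ifs with h1 h2
      · exfalso
        subst h1 h2
        obtain rfl : d = m := by rw [← hadm, one_mul]
        apply hj
        push_cast
        linear_combination -hidx
      · rfl
      · rfl
  simp only [hterm] at hS
  exact hS.unique (hasSum_ite_eq _ _)

/-- If `f` is an eigenfunction of `T_m` with eigenvalue `ev` and `(m, D) = 1`, then its Fourier
coefficients satisfy `c(k (m - 1) / 12) = ev c(0)`. -/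
theorem fourierCoeff_index_eq {k : ℤ} (hk : k ≠ 0) {R : ℝ} (hR : R ≠ 0) {f : ℍ → ℂ} {c : ℤ → ℂ}
    (hc : HasFourierExpansion k R f c) {m : ℕ} (hm : 0 < m) (hmk : k * m ≡ k [ZMOD 12])
    (hD : Int.gcd m (D k) = 1) {ev : ℂ} (hev : hecke k m f = ev • f) :
    c (index k m) = ev * c 0 := by
  have hkR : (k : ℝ) / 12 ≠ 0 := div_ne_zero (by exact_mod_cast hk) (by norm_num)
  obtain ⟨y, hy, hne⟩ := exists_radialFactor_ne_zero k hR hkR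
  have hmC : (Real.sqrt m : ℂ) ≠ 0 := by
    exact_mod_cast (Real.sqrt_pos.2 (by exact_mod_cast hm)).ne'
  have hleft : ∫ s in (0 : ℝ)..1,
      f (UpperHalfPlane.ofComplex ⟨12 * m * s, y⟩) * e (-(k * m * s)) =
        c 0 * radialFactor k R (k / 12) y := by
    have h : ∀ s : ℝ, HasSum (fun j : ℤ => c j * radialFactor k R (j + k / 12) y *
        e ((12 * j * m : ℤ) * s))
        (f (UpperHalfPlane.ofComplex ⟨12 * m * s, y⟩) * e (-(k * m * s))) := by
      intro s
      have h1 := (hasSum_comp_ofComplex hc (w := ⟨12 * m * s, y⟩) hy).mul_right (e (-(k * m * s)))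
      refine h1.congr_fun ?_
      intro j
      rw [← mul_assoc, mul_assoc _ (e _) (e _), ← e_add]
      congr 2
      push_cast
      ring
    have h2 := (continuous_and_hasSum_integral h).2
    have h3 : ∀ j : ℤ, (if (12 * j * m : ℤ) = 0 then c j * radialFactor k R (j + k / 12) y else 0) =
        if j = 0 then c 0 * radialFactor k R (k / 12) y else 0 := by
      intro j
      by_cases hj : j = 0
      · simp [hj]
      · simp [hj, hm.ne']
    simp only [h3] at h2
    exact h2.unique (hasSum_ite_eq _ _)
  have hright : ∫ s in (0 : ℝ)..1,
      hecke k m f (UpperHalfPlane.ofComplex ⟨12 * m * s, y⟩) * e (-(k * m * s)) =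
        c (index k m) * radialFactor k R (k / 12) y := by
    have h1 : ∀ s : ℝ, hecke k m f (UpperHalfPlane.ofComplex ⟨12 * m * s, y⟩) * e (-(k * m * s)) =
        1 / (Real.sqrt m : ℂ) * ∑ p ∈ m.divisorsAntidiagonal, ∑ b ∈ Finset.range p.2,
          triangularSlash k (f ∘ UpperHalfPlane.ofComplex) p.1 p.2 b ⟨12 * m * s, y⟩ *
            e (-(k * m * s)) := by
      intro s
      rw [hecke_apply, UpperHalfPlane.ofComplex_apply_of_im_pos hy]
      simp only [Finset.sum_mul, mul_assoc]
    have hint : ∀ p ∈ m.divisorsAntidiagonal, ∀ b ∈ Finset.range p.2,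
        IntervalIntegrable (fun s : ℝ => triangularSlash k (f ∘ UpperHalfPlane.ofComplex) p.1 p.2 b
          ⟨12 * m * s, y⟩ * e (-(k * m * s))) volume 0 1 := fun p hp b _ =>
      (continuous_and_hasSum_integral fun s => hasSum_triangularSlash hc hm
        (Nat.mem_divisorsAntidiagonal.1 hp).1 b hy s).1.intervalIntegrable _ _
    simp only [h1]
    rw [intervalIntegral.integral_const_mul, intervalIntegral.integral_finsetSum fun p hp => by
      simpa only [Finset.sum_fn] using IntervalIntegrable.sum _ (hint p hp)]
    have h2 : ∀ p ∈ m.divisorsAntidiagonal, ∫ s in (0 : ℝ)..1, ∑ b ∈ Finset.range p.2,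
        triangularSlash k (f ∘ UpperHalfPlane.ofComplex) p.1 p.2 b ⟨12 * m * s, y⟩ *
          e (-(k * m * s)) =
        if p = (1, m) then m * (c (index k m) * radialFactor k R (k / 12 * m) (y / m)) else 0 := by
      intro p hp
      obtain ⟨hp', -⟩ := Nat.mem_divisorsAntidiagonal.1 hp
      rw [intervalIntegral.integral_finsetSum (hint p hp),
        sum_integral_triangularSlash hc hm hmk hD hp' hy]
      refine if_congr ⟨fun h => ?_, fun h => by rw [h]⟩ rfl rfl
      exact Prod.ext h (by rw [← hp', h, one_mul])
    rw [Finset.sum_congr rfl h2, Finset.sum_ite_eq',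
      if_pos (Nat.mem_divisorsAntidiagonal.2 ⟨one_mul m, hm.ne'⟩), radialFactor_mul_div _ _ _ _ hm]
    -- The `m` values of `b` compensate two factors `m^(-1/2)`: one from the normalization of `T_m`,
    -- one from rescaling the radial factor.
    have hmm : (Real.sqrt m : ℂ) * Real.sqrt m = m := by
      exact_mod_cast Real.mul_self_sqrt (Nat.cast_nonneg m)
    rw [← hmm]
    field_simp
  rw [hev] at hright
  simp only [Pi.smul_apply, smul_eq_mul, mul_assoc] at hright
  rw [intervalIntegral.integral_const_mul] at hright
  simp only [mul_assoc] at hleft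
  rw [hleft] at hright
  refine mul_right_cancel₀ hne ?_
  rw [← hright]
  ring

/-! ### Passage to the index `mn/d²` and the final deduction -/

theorem hecke_smul (k : ℤ) (m : ℕ) (c : ℂ) (f : ℍ → ℂ) : hecke k m (c • f) = c • hecke k m f := by
  ext z
  simp only [hecke, Pi.smul_apply, smul_eq_mul, Finset.mul_sum]
  refine Finset.sum_congr rfl fun p _ => Finset.sum_congr rfl fun b _ => ?_
  ring

theorem mul_div_sq_pos {m n d : ℕ} (hm : 0 < m) (hn : 0 < n) (hd : d ∣ Nat.gcd m n) :
    0 < m * n / d ^ 2 := by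
  have h2 : d ^ 2 ∣ m * n := sq_dvd_mul_of_dvd_gcd hd
  exact Nat.div_pos (Nat.le_of_dvd (Nat.mul_pos hm hn) h2)
    (pow_pos (Nat.pos_of_dvd_of_pos hd (Nat.gcd_pos_of_pos_left _ hm)) 2)

theorem index_mul_div_sq {k : ℤ} {m n d : ℕ} (hm : 0 < m) (hd : d ∣ Nat.gcd m n) :
    index k (m * n / d ^ 2) = indexMul k m n d := by
  have hd0 : 0 < d := Nat.pos_of_dvd_of_pos hd (Nat.gcd_pos_of_pos_left _ hm)
  obtain ⟨q, hq⟩ : d ^ 2 ∣ m * n := sq_dvd_mul_of_dvd_gcd hd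
  have hq' : (m : ℤ) * n = d ^ 2 * q := by exact_mod_cast hq
  rw [index, indexMul, hq, Nat.mul_div_cancel_left _ (pow_pos hd0 2), hq',
    show k * ((d : ℤ) ^ 2 * q - d ^ 2) = k * (q - 1) * d ^ 2 by ring,
    Int.mul_ediv_mul_of_pos_left _ _ (by positivity)]

/-- Needed to apply `fourierCoeff_index_eq` at `mn/d²`, a divisor of `mn`. -/
theorem gcd_mul_div_sq {m n d : ℕ} {D : ℤ} (hm : Int.gcd m D = 1) (hn : Int.gcd n D = 1)
    (hd : d ∣ Nat.gcd m n) : Int.gcd (m * n / d ^ 2 : ℕ) D = 1 := by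
  have h2 : d ^ 2 ∣ m * n := sq_dvd_mul_of_dvd_gcd hd
  rw [← Int.isCoprime_iff_gcd_eq_one] at hm hn ⊢
  refine (hm.mul_left hn).of_isCoprime_of_dvd_left ?_
  exact_mod_cast Nat.div_dvd_of_dvd h2

end MaassHecke

theorem mainTheorem5 (k : ℤ) (hk : ¬ (12 : ℤ) ∣ k) (R : ℝ) (hR : R ≠ 0) (f : ℍ → ℂ)
    (hf : MaassHecke.IsMaassWaveform (MaassHecke.multiplier k) k R f) (hf0 : f ≠ 0)
    (ev : ℕ → ℂ)
    (hev : ∀ m : ℕ, 0 < m → k * m ≡ k [ZMOD 12] → MaassHecke.hecke k m f = ev m • f) :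
    (∀ m n : ℕ, 0 < m → 0 < n → k * m ≡ k [ZMOD 12] → k * n ≡ k [ZMOD 12] →
      ev m * ev n =
        ∑ d ∈ (Nat.gcd m n).divisors, MaassHecke.chi k d * ev (m * n / d ^ 2)) ∧
    (∀ c : ℤ → ℂ, MaassHecke.HasFourierExpansion k R f c →
      ∀ m n : ℕ, 0 < m → 0 < n → k * m ≡ k [ZMOD 12] → k * n ≡ k [ZMOD 12] →
        Int.gcd m (MaassHecke.D k) = 1 → Int.gcd n (MaassHecke.D k) = 1 →
        c (MaassHecke.index k m) * c (MaassHecke.index k n) =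
          c 0 * ∑ d ∈ (Nat.gcd m n).divisors,
            MaassHecke.chi k d * c (MaassHecke.indexMul k m n d)) := by
  have hk0 : k ≠ 0 := fun h => hk (h ▸ dvd_zero 12)
  have hmul : ∀ m n : ℕ, 0 < m → 0 < n → k * m ≡ k [ZMOD 12] → k * n ≡ k [ZMOD 12] →
      ev m * ev n =
        ∑ d ∈ (Nat.gcd m n).divisors, MaassHecke.chi k d * ev (m * n / d ^ 2) := by
    intro m n hm hn hmk hnk
    obtain ⟨z, hz⟩ := Function.ne_iff.1 hf0
    have h := MaassHecke.hecke_hecke (fun w hw => hf.comp_ofComplex_add_one hw) hm hn hmk hnk z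
    rw [hev n hn hnk, MaassHecke.hecke_smul, hev m hm hmk] at h
    refine mul_right_cancel₀ hz ?_
    rw [Finset.sum_mul, mul_comm (ev m), mul_assoc]
    refine h.trans (Finset.sum_congr rfl fun d hd => ?_)
    have hd' := Nat.dvd_of_mem_divisors hd
    rw [hev _ (MaassHecke.mul_div_sq_pos hm hn hd')
      (MaassHecke.mul_div_sq_modEq (Nat.pos_of_mem_divisors hd) hmk hnk hd'), mul_assoc]
    rfl
  refine ⟨hmul, fun c hc m n hm hn hmk hnk hmD hnD => ?_⟩
  rw [MaassHecke.fourierCoeff_index_eq hk0 hR hc hm hmk hmD (hev m hm hmk),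
    MaassHecke.fourierCoeff_index_eq hk0 hR hc hn hnk hnD (hev n hn hnk)]
  have h : ∀ d ∈ (Nat.gcd m n).divisors, MaassHecke.chi k d * c (MaassHecke.indexMul k m n d) =
      MaassHecke.chi k d * ev (m * n / d ^ 2) * c 0 := by
    intro d hd
    have hd' := Nat.dvd_of_mem_divisors hd
    have hpos := MaassHecke.mul_div_sq_pos hm hn hd'
    have hmod := MaassHecke.mul_div_sq_modEq (Nat.pos_of_mem_divisors hd) hmk hnk hd'
    rw [← MaassHecke.index_mul_div_sq hm hd', MaassHecke.fourierCoeff_index_eq hk0 hR hc hpos hmod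
      (MaassHecke.gcd_mul_div_sq hmD hnD hd') (hev _ hpos hmod), mul_assoc]
  rw [Finset.sum_congr rfl h, ← Finset.sum_mul, ← hmul m n hm hn hmk hnk]
  ring
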